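/- Let $0\le k\le n$ and $d,r\ge 0$ be integers, and let $Z_1,\dots,Z_n$ be random real $d\times r$ matrices on a common probability space such that all $ndr$ entries are independent and identically distributed with a common law that is symmetric about $0$ (that is, $z$ and $-z$ have the same distribution). Put $A_i=Z_iZ_i^T$. For a matrix-valued function $f$ of $k$ matrices, write $$\mathbb E_{\mathrm{wo}}[f(A_{i_1},\dots,A_{i_k})]=\frac{(n-k)!}{n!}\sum_{\substack{j_1,\dots,j_k\in\{1,\dots,n\}\\ \text{pairwise distinct}}} f(A_{j_1},\dots,A_{j_k}),\qquad \mathbb E_{\mathrm{wr}}[f(A_{i_1},\dots,A_{i_k})]=\frac1{n^k}\sum_{j_1,\dots,j_k=1}^n f(A_{j_1},\dots,A_{j_k})$$ for the without-replacement and with-replacement averages (which are random matrices), let $\mathbb E$ denote the entrywise expectation over the random matrices $A_i$, and let $\|\cdot\|$ be the spectral norm (the operator norm induced by the Euclidean norm). Then: 1. if the expectation $\mathbb E\,\mathbb E_{\mathrm{wr}}[A_{i_1}A_{i_2}\cdots A_{i_k}]$ exists (all entries are integrable), then so does $\mathbb E\,\mathbb E_{\mathrm{wo}}[A_{i_1}A_{i_2}\cdots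 A_{i_k}]$, and $$\bigl\|\mathbb E\,\mathbb E_{\mathrm{wo}}[A_{i_1}\cdots A_{i_k}]\bigr\|\le\bigl\|\mathbb E\,\mathbb E_{\mathrm{wr}}[A_{i_1}\cdots A_{i_k}]\bigr\|;$$ 2. if the expectation $\mathbb E\,\mathbb E_{\mathrm{wr}}[A_{i_k}\cdots A_{i_1}A_{i_1}\cdots A_{i_k}]$ exists, then so does $\mathbb E\,\mathbb E_{\mathrm{wo}}[A_{i_k}\cdots A_{i_1}A_{i_1}\cdots A_{i_k}]$, and $$\bigl\|\mathbb E\,\mathbb E_{\mathrm{wo}}[A_{i_k}\cdots A_{i_1}A_{i_1}\cdots A_{i_k}]\bigr\|\le\bigl\|\mathbb E\,\mathbb E_{\mathrm{wr}}[A_{i_k}\cdots A_{i_1}A_{i_1}\cdots A_{i_k}]\bigr\|.$$ -/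

import Mathlib

open MeasureTheory ProbabilityTheory
open scoped Matrix Matrix.Norms.L2Operator Nat

noncomputable section

/-- Without-replacement expectation: the average of `f (x_{j_1}, …, x_{j_k})` over all ordered
`k`-tuples of pairwise distinct indices from `Fin n` (meant for `k ≤ n`). -/
def woMean {D E : Type*} [AddCommGroup E] [Module ℝ E] {n k : ℕ}
    (f : (Fin k → D) → E) (x : Fin n → D) : E :=
  (((n - k)! : ℝ) / (n ! : ℝ)) • ∑ j : Fin k ↪ Fin n, f (fun l => x (j l))

/-- With-replacement expectation: the average of `f (x_{j_1}, …, x_{j_k})` over all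
`k`-tuples of indices from `Fin n`. -/
def wrMean {D E : Type*} [AddCommGroup E] [Module ℝ E] {n k : ℕ}
    (f : (Fin k → D) → E) (x : Fin n → D) : E :=
  ((n : ℝ) ^ k)⁻¹ • ∑ j : Fin k → Fin n, f (fun l => x (j l))

/-- The ordered product `B₁ B₂ ⋯ B_k`. -/
def orderedProd {d k : ℕ} (B : Fin k → Matrix (Fin d) (Fin d) ℝ) : Matrix (Fin d) (Fin d) ℝ :=
  (List.ofFn B).prod

/-- The product `B_k ⋯ B₂ B₁ B₁ B₂ ⋯ B_k`. -/
def palindromicProd {d k : ℕ} (B : Fin k → Matrix (Fin d) (Fin d) ℝ) :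
    Matrix (Fin d) (Fin d) ℝ :=
  orderedProd (fun j => B j.rev) * orderedProd B

/-- The expectation of the random matrix `M` exists: all its entries are integrable. -/
def HasMatrixExpectation {Ω : Type*} [MeasurableSpace Ω] {d : ℕ}
    (P : Measure Ω) (M : Ω → Matrix (Fin d) (Fin d) ℝ) : Prop :=
  ∀ a b, Integrable (fun ω => M ω a b) P

/-- The entrywise expectation of a random matrix. -/
def matrixExpectation {Ω : Type*} [MeasurableSpace Ω] {d : ℕ}
    (P : Measure Ω) (M : Ω → Matrix (Fin d) (Fin d) ℝ) : Matrix (Fin d) (Fin d) ℝ :=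
  Matrix.of fun a b => ∫ ω, M ω a b ∂P

end

/-! ### Moments of a symmetric law -/

/-! Every entry of either product of the `Z Zᵀ` is a polynomial with nonnegative coefficients in the
entries of `k` matrix blocks, and an index tuple `j` merely identifies some of these blocks.
Expectations of monomials factor into moments of `ν`: odd moments vanish, even ones satisfy `E x^p *
E x^q ≤ E x^(p+q)`, so merging variables can only increase an expectation. Distinct indices merge
nothing; hence all terms of the without-replacement mean share one expectation `c ≥ 0`, and every
term of the with-replacement mean has expectation at least `c`. The expected matrices thus compare
entrywise, and the spectral norm is monotone on entrywise nonnegative matrices.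

All this needs a finite moment of order `K`, the degree of the polynomial. It is recovered from
integrability of the with-replacement mean: averaging over signs leaves only even monomials, which
decrease when all variables but one are set to zero, and what remains dominates the `K`-th power of
that variable (`IsNonnegPolynomial.integrable_pow`). -/

lemma integrable_pow_of_le {ν : Measure ℝ} [IsFiniteMeasure ν] {K p : ℕ} (hp : p ≤ K)
    (hK : Integrable (fun x : ℝ => x ^ K) ν) : Integrable (fun x : ℝ => x ^ p) ν := by
  have h : Integrable (fun x : ℝ => ‖x‖ ^ p) ν :=
    integrable_norm_pow_of_le (f := fun x : ℝ => x) (by fun_prop) hp (by simpa using hK.norm)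
  exact h.mono' (by fun_prop) (by simp)

lemma integral_odd_pow_eq_zero {ν : Measure ℝ} (hν : ν.map (fun x => -x) = ν) {p : ℕ}
    (hp : Odd p) : ∫ x, x ^ p ∂ν = 0 := by
  have h : ∫ x, x ^ p ∂ν = -∫ x, x ^ p ∂ν := by
    conv_lhs => rw [← hν]
    rw [integral_map (by fun_prop) (by fun_prop)]
    simp [hp.neg_pow, integral_neg]
  linarith

lemma integral_pow_nonneg {ν : Measure ℝ} (hν : ν.map (fun x => -x) = ν) (p : ℕ) :
    0 ≤ ∫ x, x ^ p ∂ν := by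
  rcases Nat.even_or_odd p with hp | hp
  · exact integral_nonneg fun x => hp.pow_nonneg x
  · exact (integral_odd_pow_eq_zero hν hp).ge

/-- Both factors increase with `|x|` and vanish at `|x| = t`, so they share a sign: the pointwise
form of Chebyshev's correlation inequality. -/
lemma even_pow_sub_mul_even_pow_sub_nonneg {p q : ℕ} (hp : Even p) (hq : Even q) (x : ℝ) {t : ℝ}
    (ht : 0 ≤ t) : 0 ≤ (x ^ p - t ^ p) * (x ^ q - t ^ q) := by
  rw [← hp.pow_abs x, ← hq.pow_abs x]
  rcases le_total |x| t with h | h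
  · exact mul_nonneg_of_nonpos_of_nonpos
      (sub_nonpos.2 (pow_le_pow_left₀ (abs_nonneg x) h p))
      (sub_nonpos.2 (pow_le_pow_left₀ (abs_nonneg x) h q))
  · exact mul_nonneg (sub_nonneg.2 (pow_le_pow_left₀ ht h p))
      (sub_nonneg.2 (pow_le_pow_left₀ ht h q))

/-- The moments of a symmetric probability law are supermultiplicative. -/
lemma integral_pow_mul_integral_pow_le {ν : Measure ℝ} [IsProbabilityMeasure ν]
    (hν : ν.map (fun x => -x) = ν) {p q : ℕ} (hpq : Integrable (fun x : ℝ => x ^ (p + q)) ν) :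
    (∫ x, x ^ p ∂ν) * ∫ x, x ^ q ∂ν ≤ ∫ x, x ^ (p + q) ∂ν := by
  rcases Nat.even_or_odd p with hp | hp
  swap
  · rw [integral_odd_pow_eq_zero hν hp, zero_mul]
    exact integral_pow_nonneg hν _
  rcases Nat.even_or_odd q with hq | hq
  swap
  · rw [integral_odd_pow_eq_zero hν hq, mul_zero]
    exact integral_pow_nonneg hν _
  rcases Nat.eq_zero_or_pos p with rfl | hp0
  · simp
  -- With `t ^ p` equal to the `p`-th moment, the terms in `t ^ q` cancel after integration. Taking
  -- this root requires `p > 0`.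
  obtain ⟨t, ht, htp⟩ : ∃ t : ℝ, 0 ≤ t ∧ t ^ p = ∫ x, x ^ p ∂ν :=
    ⟨(∫ x, x ^ p ∂ν) ^ ((p : ℝ)⁻¹), Real.rpow_nonneg (integral_pow_nonneg hν p) _,
      Real.rpow_inv_natCast_pow (integral_pow_nonneg hν p) hp0.ne'⟩
  have ip := integrable_pow_of_le (Nat.le_add_right p q) hpq
  have iq := integrable_pow_of_le (Nat.le_add_left q p) hpq
  have h : 0 ≤ ∫ x, (x ^ p - t ^ p) * (x ^ q - t ^ q) ∂ν :=
    integral_nonneg fun x => even_pow_sub_mul_even_pow_sub_nonneg hp hq x ht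
  have e : ∀ x : ℝ, (x ^ p - t ^ p) * (x ^ q - t ^ q)
      = x ^ (p + q) - t ^ q * x ^ p - (t ^ p * x ^ q - t ^ p * t ^ q) := fun x => by ring
  simp_rw [e] at h
  rw [integral_sub (by exact hpq.sub (ip.const_mul _))
      (by exact (iq.const_mul _).sub (integrable_const _)), integral_sub hpq (ip.const_mul _), integral_sub (iq.const_mul _) (integrable_const _),
    integral_const_mul, integral_const_mul, integral_const] at h
  simp only [probReal_univ, one_smul] at h
  rw [htp] at h
  nlinarith [h]

lemma prod_integral_pow_le {ν : Measure ℝ} [IsProbabilityMeasure ν]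
    (hν : ν.map (fun x => -x) = ν) {σ : Type*} (s : Finset σ) (m : σ → ℕ)
    (hm : Integrable (fun x : ℝ => x ^ (∑ i ∈ s, m i)) ν) :
    ∏ i ∈ s, ∫ x, x ^ m i ∂ν ≤ ∫ x, x ^ (∑ i ∈ s, m i) ∂ν := by
  classical
  induction s using Finset.induction_on with
  | empty => simp
  | insert a s ha ih =>
    rw [Finset.sum_insert ha] at hm ⊢
    rw [Finset.prod_insert ha]
    exact (mul_le_mul_of_nonneg_left (ih (integrable_pow_of_le (Nat.le_add_left _ _) hm))
      (integral_pow_nonneg hν _)).trans (integral_pow_mul_integral_pow_le hν hm)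

/-! ### Polynomial functions with nonnegative coefficients -/

/-- `F` is a polynomial function of degree at most `K` with nonnegative coefficients. -/
def IsNonnegPolynomial {σ : Type*} (K : ℕ) (F : (σ → ℝ) → ℝ) : Prop :=
  ∃ p : MvPolynomial σ ℝ, (∀ m, 0 ≤ p.coeff m) ∧ p.totalDegree ≤ K ∧
    ∀ x, F x = MvPolynomial.eval x p

namespace IsNonnegPolynomial

variable {σ τ : Type*} {K L : ℕ} {F G : (σ → ℝ) → ℝ}

lemma const {c : ℝ} (hc : 0 ≤ c) : IsNonnegPolynomial K fun _ : σ → ℝ => c := by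
  classical
  refine ⟨MvPolynomial.C c, fun m => ?_, by simp, by simp⟩
  rw [MvPolynomial.coeff_C]
  split_ifs <;> simp [hc]

lemma var (s : σ) : IsNonnegPolynomial 1 fun x : σ → ℝ => x s := by
  classical
  refine ⟨MvPolynomial.X s, fun m => ?_, by simp, by simp⟩
  rw [MvPolynomial.coeff_X]
  split_ifs <;> simp

lemma add (hF : IsNonnegPolynomial K F) (hG : IsNonnegPolynomial K G) :
    IsNonnegPolynomial K fun x => F x + G x := by
  obtain ⟨p, hp, dp, ep⟩ := hF
  obtain ⟨q, hq, dq, eq⟩ := hG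
  refine ⟨p + q, fun m => ?_, (MvPolynomial.totalDegree_add p q).trans (max_le dp dq), ?_⟩
  · rw [MvPolynomial.coeff_add]
    exact add_nonneg (hp m) (hq m)
  · simp [ep, eq]

lemma mul (hF : IsNonnegPolynomial K F) (hG : IsNonnegPolynomial L G) :
    IsNonnegPolynomial (K + L) fun x => F x * G x := by
  classical
  obtain ⟨p, hp, dp, ep⟩ := hF
  obtain ⟨q, hq, dq, eq⟩ := hG
  refine ⟨p * q, fun m => ?_, (MvPolynomial.totalDegree_mul p q).trans (add_le_add dp dq), ?_⟩
  · rw [MvPolynomial.coeff_mul]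
    exact Finset.sum_nonneg fun i _ => mul_nonneg (hp _) (hq _)
  · simp [ep, eq]

lemma sum {ι : Type*} (s : Finset ι) {F : ι → (σ → ℝ) → ℝ}
    (hF : ∀ i ∈ s, IsNonnegPolynomial K (F i)) : IsNonnegPolynomial K fun x => ∑ i ∈ s, F i x := by
  classical
  induction s using Finset.induction_on with
  | empty => simpa using const le_rfl
  | insert a s ha ih =>
    simp_rw [Finset.sum_insert ha]
    exact (hF a (by simp)).add (ih fun i hi => hF i (by simp [hi]))

lemma rename (g : σ → τ) (hF : IsNonnegPolynomial K F) :
    IsNonnegPolynomial K fun x : τ → ℝ => F (x ∘ g) := by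
  classical
  obtain ⟨p, hp, dp, ep⟩ := hF
  refine ⟨MvPolynomial.rename g p, fun m => ?_, (MvPolynomial.totalDegree_rename_le g p).trans dp,
    fun x => by simp [ep, MvPolynomial.eval_rename]⟩
  rw [p.as_sum, map_sum, MvPolynomial.coeff_sum]
  refine Finset.sum_nonneg fun u _ => ?_
  rw [MvPolynomial.rename_monomial, MvPolynomial.coeff_monomial]
  split_ifs
  exacts [hp u, le_rfl]

variable {ι κ : Type*} [Fintype ι]

lemma matrix_mul {ρ : Type*} {M : (σ → ℝ) → Matrix ρ ι ℝ} {N : (σ → ℝ) → Matrix ι κ ℝ}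
    (hM : ∀ a b, IsNonnegPolynomial K fun x => M x a b)
    (hN : ∀ a b, IsNonnegPolynomial L fun x => N x a b) (a : ρ) (b : κ) :
    IsNonnegPolynomial (K + L) fun x => (M x * N x) a b := by
  simp_rw [Matrix.mul_apply]
  exact sum _ fun i _ => (hM a i).mul (hN i b)

lemma matrix_mul_transpose {M : (σ → ℝ) → Matrix κ ι ℝ}
    (hM : ∀ a b, IsNonnegPolynomial K fun x => M x a b) (a b : κ) :
    IsNonnegPolynomial (K + K) fun x => (M x * (M x)ᵀ) a b :=
  matrix_mul hM (fun i j => hM j i) a b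

lemma orderedProd {k d : ℕ} {B : (σ → ℝ) → Fin k → Matrix (Fin d) (Fin d) ℝ}
    (hB : ∀ l a b, IsNonnegPolynomial K fun x => B x l a b) (a b : Fin d) :
    IsNonnegPolynomial (k * K) fun x => _root_.orderedProd (B x) a b := by
  induction k generalizing a b with
  | zero =>
    simp only [_root_.orderedProd, List.ofFn_zero, List.prod_nil, Matrix.one_apply]
    exact const (by split_ifs <;> simp)
  | succ k ih =>
    simp only [_root_.orderedProd, List.ofFn_succ, List.prod_cons]
    rw [Nat.succ_mul, add_comm]
    exact matrix_mul (hB 0) (ih fun l => hB l.succ) a b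

lemma palindromicProd {k d : ℕ} {B : (σ → ℝ) → Fin k → Matrix (Fin d) (Fin d) ℝ}
    (hB : ∀ l a b, IsNonnegPolynomial K fun x => B x l a b) (a b : Fin d) :
    IsNonnegPolynomial (k * K + k * K) fun x => _root_.palindromicProd (B x) a b :=
  matrix_mul (orderedProd fun l => hB l.rev) (orderedProd hB) a b

end IsNonnegPolynomial

/-! ### Expectation of nonnegative polynomials in i.i.d. symmetric variables -/

section Expectation

variable {σ τ : Type*} [Fintype σ] [Fintype τ] {ν : Measure ℝ} [IsProbabilityMeasure ν]

lemma prod_pow_comp [DecidableEq τ] (g : σ → τ) (m : σ → ℕ) (x : τ → ℝ) :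
    ∏ s, x (g s) ^ m s = ∏ t, x t ^ ∑ s with g s = t, m s := by
  rw [← Finset.prod_fiberwise Finset.univ g]
  refine Finset.prod_congr rfl fun t _ => ?_
  rw [← Finset.prod_pow_eq_pow_sum]
  exact Finset.prod_congr rfl fun s hs => by rw [(Finset.mem_filter.1 hs).2]

lemma integrable_monomial_comp {K : ℕ} (hK : Integrable (fun x : ℝ => x ^ K) ν) (g : σ → τ)
    {m : σ → ℕ} (hm : ∑ s, m s ≤ K) :
    Integrable (fun x : τ → ℝ => ∏ s, x (g s) ^ m s) (Measure.pi fun _ => ν) := by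
  classical
  rw [funext (prod_pow_comp g m)]
  exact Integrable.fintype_prod (f := fun t (y : ℝ) => y ^ ∑ s with g s = t, m s) fun t =>
    integrable_pow_of_le ((Finset.sum_le_univ_sum_of_nonneg fun _ => Nat.zero_le _).trans hm) hK

/-- Independence splits the integral over the fibres of `g`; within a fibre the exponents add up and
supermultiplicativity of moments applies. -/
lemma prod_integral_pow_le_integral_monomial_comp (hν : ν.map (fun x => -x) = ν) {K : ℕ}
    (hK : Integrable (fun x : ℝ => x ^ K) ν) (g : σ → τ) {m : σ → ℕ} (hm : ∑ s, m s ≤ K) :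
    ∏ s, ∫ x, x ^ m s ∂ν ≤ ∫ x : τ → ℝ, ∏ s, x (g s) ^ m s ∂(Measure.pi fun _ => ν) := by
  classical
  rw [funext (prod_pow_comp g m)]
  rw [integral_fintype_prod_eq_prod (fun t (y : ℝ) => y ^ ∑ s with g s = t, m s),
    ← Finset.prod_fiberwise Finset.univ g]
  exact Finset.prod_le_prod
    (fun t _ => Finset.prod_nonneg fun s _ => integral_pow_nonneg hν _)
    fun t _ => prod_integral_pow_le hν _ m <|
      integrable_pow_of_le ((Finset.sum_le_univ_sum_of_nonneg fun _ => Nat.zero_le _).trans hm) hK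

lemma integral_monomial_comp_of_injective {g : σ → τ} (hg : g.Injective) (m : σ → ℕ) :
    ∫ x : τ → ℝ, ∏ s, x (g s) ^ m s ∂(Measure.pi fun _ => ν) = ∏ s, ∫ x, x ^ m s ∂ν := by
  classical
  rw [funext (prod_pow_comp g m)]
  rw [integral_fintype_prod_eq_prod (fun t (y : ℝ) => y ^ ∑ s with g s = t, m s),
    ← Finset.prod_fiberwise Finset.univ g]
  refine Finset.prod_congr rfl fun t _ => ?_
  by_cases h : ∃ s, g s = t
  · obtain ⟨s, rfl⟩ := h
    have hs : ({s' | g s' = g s} : Finset σ) = {s} := by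
      ext s'
      simp [hg.eq_iff]
    simp [hs]
  · push Not at h
    simp [h]

/-- For a polynomial with nonnegative coefficients in i.i.d. symmetric variables, the expectation
exists after any identification of variables and is minimal when no variables are identified. -/
lemma IsNonnegPolynomial.exists_integral_comp_ge (hν : ν.map (fun x => -x) = ν) {K : ℕ}
    (hK : Integrable (fun x : ℝ => x ^ K) ν) {F : (σ → ℝ) → ℝ} (hF : IsNonnegPolynomial K F) :
    ∃ c : ℝ, 0 ≤ c ∧ ∀ g : σ → τ,
      Integrable (fun x : τ → ℝ => F (x ∘ g)) (Measure.pi fun _ => ν) ∧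
      c ≤ ∫ x : τ → ℝ, F (x ∘ g) ∂(Measure.pi fun _ => ν) ∧
      (g.Injective → ∫ x : τ → ℝ, F (x ∘ g) ∂(Measure.pi fun _ => ν) = c) := by
  classical
  obtain ⟨p, hp, dp, ep⟩ := hF
  have deg : ∀ m ∈ p.support, ∑ s, m s ≤ K := fun m hm => by
    have := MvPolynomial.le_totalDegree hm
    rw [Finsupp.sum_fintype _ _ fun _ => rfl] at this
    exact this.trans dp
  -- The witness is the expectation of `F` when all its variables are independent.
  refine ⟨∑ m ∈ p.support, p.coeff m * ∏ s, ∫ x, x ^ m s ∂ν, Finset.sum_nonneg fun m _ =>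
    mul_nonneg (hp m) (Finset.prod_nonneg fun s _ => integral_pow_nonneg hν _), fun g => ?_⟩
  have int : ∀ m ∈ p.support, Integrable (fun x : τ → ℝ => p.coeff m * ∏ s, x (g s) ^ m s)
      (Measure.pi fun _ => ν) := fun m hm =>
    (integrable_monomial_comp hK g (deg m hm)).const_mul _
  simp_rw [ep, MvPolynomial.eval_eq', Function.comp_apply]
  rw [integral_finsetSum _ int]
  simp_rw [integral_const_mul]
  refine ⟨integrable_finsetSum _ int, Finset.sum_le_sum fun m hm => ?_, fun hg => ?_⟩
  · exact mul_le_mul_of_nonneg_left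
      (prod_integral_pow_le_integral_monomial_comp hν hK g (deg m hm)) (hp m)
  · simp_rw [integral_monomial_comp_of_injective hg]

/-! ### Recovering moments by sign symmetrisation -/

/-- The sign `1` or `-1` encoded by a Boolean. -/
def boolSign (e : Bool) : ℝ := if e then 1 else -1

lemma measurePreserving_boolSign_mul (hν : ν.map (fun x => -x) = ν) (e : τ → Bool) :
    MeasurePreserving (fun x : τ → ℝ => fun t => boolSign (e t) * x t)
      (Measure.pi fun _ => ν) (Measure.pi fun _ => ν) := by
  refine measurePreserving_pi (fun _ : τ => ν) (fun _ => ν)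
    (f := fun t y => boolSign (e t) * y) fun t => ?_
  cases e t
  · simpa [boolSign] using (⟨measurable_neg, hν⟩ : MeasurePreserving (fun x : ℝ => -x) ν ν)
  · simpa [boolSign, Function.id_def] using MeasurePreserving.id ν

/-- Expanding the right side chooses one sign per variable; a factor with odd exponent cancels. -/
lemma sum_boolSign_monomial [DecidableEq τ] (m : τ → ℕ) (x : τ → ℝ) :
    ∑ e : τ → Bool, ∏ t, (boolSign (e t) * x t) ^ m t = ∏ t, (x t ^ m t + (-x t) ^ m t) := by
  have h := Finset.prod_univ_sum (fun _ : τ => (Finset.univ : Finset Bool))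
    (fun t e => (boolSign e * x t) ^ m t)
  rw [Fintype.piFinset_univ] at h
  rw [← h]
  simp [boolSign]

lemma pow_add_neg_pow_nonneg (m : ℕ) (x : ℝ) : 0 ≤ x ^ m + (-x) ^ m := by
  rcases Nat.even_or_odd m with h | h
  · rw [h.neg_pow]
    linarith [h.pow_nonneg x]
  · rw [h.neg_pow]
    simp

lemma pow_add_neg_pow_le (m : ℕ) {x y : ℝ} (h : |y| ≤ |x|) :
    y ^ m + (-y) ^ m ≤ x ^ m + (-x) ^ m := by
  rcases Nat.even_or_odd m with hm | hm
  · have := pow_le_pow_left₀ (abs_nonneg y) h m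
    rw [hm.pow_abs, hm.pow_abs] at this
    rw [hm.neg_pow, hm.neg_pow]
    linarith
  · simp [hm.neg_pow]

/-- The even part of a polynomial with nonnegative coefficients is monotone in the absolute values
of the variables. -/
lemma IsNonnegPolynomial.sum_boolSign_mono [DecidableEq τ] {K : ℕ} {F : (τ → ℝ) → ℝ}
    (hF : IsNonnegPolynomial K F) {x y : τ → ℝ} (h : ∀ t, |y t| ≤ |x t|) :
    ∑ e : τ → Bool, F (fun t => boolSign (e t) * y t) ≤
      ∑ e : τ → Bool, F (fun t => boolSign (e t) * x t) := by
  obtain ⟨p, hp, -, ep⟩ := hF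
  simp_rw [ep, MvPolynomial.eval_eq']
  rw [Finset.sum_comm, Finset.sum_comm (s := Finset.univ)]
  refine Finset.sum_le_sum fun m _ => ?_
  rw [← Finset.mul_sum, ← Finset.mul_sum, sum_boolSign_monomial, sum_boolSign_monomial]
  exact mul_le_mul_of_nonneg_left (Finset.prod_le_prod
    (fun t _ => pow_add_neg_pow_nonneg _ _) fun t _ => pow_add_neg_pow_le _ (h t)) (hp m)

/-- If a polynomial with nonnegative coefficients in i.i.d. symmetric variables is integrable and
dominates `u ^ N` on one coordinate axis, then the variables have a finite `N`-th moment. -/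
lemma IsNonnegPolynomial.integrable_pow [DecidableEq τ] (hν : ν.map (fun x => -x) = ν)
    {K N : ℕ} {F : (τ → ℝ) → ℝ} (hF : IsNonnegPolynomial K F)
    (hint : Integrable F (Measure.pi fun _ => ν)) (t : τ) (hN : Even N)
    (hpow : ∀ u : ℝ, u ^ N ≤ F (Pi.single t u)) : Integrable (fun u : ℝ => u ^ N) ν := by
  have h₁ : Integrable (fun x : τ → ℝ => ∑ e : τ → Bool, F (fun t => boolSign (e t) * x t))
      (Measure.pi fun _ => ν) :=
    integrable_finsetSum _ fun e _ =>
      ((measurePreserving_boolSign_mul hν e).integrable_comp hint.1).2 hint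
  have h₂ : Integrable (fun x : τ → ℝ => x t ^ N) (Measure.pi fun _ => ν) := by
    refine h₁.mono' ((measurable_pi_apply t).pow_const N).aestronglyMeasurable
      (Filter.Eventually.of_forall fun x => ?_)
    rw [Real.norm_of_nonneg (hN.pow_nonneg _)]
    -- Setting all variables except `x t` to zero decreases the symmetrised sum.
    refine le_trans ?_ (hF.sum_boolSign_mono (y := Pi.single t (x t)) fun s => ?_)
    · have h : ∀ e : τ → Bool,
          x t ^ N ≤ F (fun s => boolSign (e s) * (Pi.single t (x t) : τ → ℝ) s) := fun e => by
        have e₁ : (fun s => boolSign (e s) * (Pi.single t (x t) : τ → ℝ) s) =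
            Pi.single t (boolSign (e t) * x t) := by
          ext s
          rcases eq_or_ne s t with rfl | hs
          · simp
          · simp [hs]
        have e₂ : (boolSign (e t) * x t) ^ N = x t ^ N := by
          cases e t <;> simp [boolSign, hN.neg_pow]
        rw [e₁, ← e₂]
        exact hpow _
      exact (h fun _ => true).trans (Finset.single_le_sum
        (f := fun e : τ → Bool => F (fun s => boolSign (e s) * (Pi.single t (x t) : τ → ℝ) s))
        (fun e _ => (hN.pow_nonneg _).trans (h e)) (Finset.mem_univ _))
    · rcases eq_or_ne s t with rfl | hs
      · simp
      · simp [hs]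
  exact ((measurePreserving_eval (fun _ : τ => ν) t).integrable_comp (by fun_prop)).1 h₂

end Expectation

/-! ### Gram matrices and the two means -/

/-- Replacing `x` by its entrywise absolute value keeps its norm, and `|M x| ≤ N |x|` in each
coordinate. -/
lemma Matrix.l2_opNorm_le_of_entrywise_le {m n : Type*} [Fintype m] [Fintype n] [DecidableEq n]
    {M N : Matrix m n ℝ} (h₀ : ∀ a b, 0 ≤ M a b) (h : ∀ a b, M a b ≤ N a b) : ‖M‖ ≤ ‖N‖ := by
  rw [Matrix.l2_opNorm_def]
  refine ContinuousLinearMap.opNorm_le_bound _ (norm_nonneg _) fun x => ?_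
  set y : EuclideanSpace ℝ n := WithLp.toLp 2 fun b => |x b| with hy
  have hxy : ‖y‖ = ‖x‖ := by simp [EuclideanSpace.norm_eq, hy]
  rw [← hxy]
  refine le_trans ?_ (Matrix.l2_opNorm_mulVec N y)
  rw [EuclideanSpace.norm_eq, EuclideanSpace.norm_eq]
  refine Real.sqrt_le_sqrt (Finset.sum_le_sum fun a _ => pow_le_pow_left₀ (norm_nonneg _) ?_ 2)
  change |∑ b, M a b * x b| ≤ |∑ b, N a b * y b|
  calc |∑ b, M a b * x b| ≤ ∑ b, |M a b * x b| := Finset.abs_sum_le_sum_abs _ _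
    _ ≤ ∑ b, N a b * y b := Finset.sum_le_sum fun b _ => by
        rw [abs_mul, abs_of_nonneg (h₀ a b)]
        exact mul_le_mul_of_nonneg_right (h a b) (abs_nonneg _)
    _ ≤ _ := le_abs_self _

/-- The matrices `Zᵢ Zᵢᵀ`, where the entries of all `Zᵢ` are listed in `y`. -/
def gram {ι : Type*} {d r : ℕ} (y : ι × Fin d × Fin r → ℝ) (i : ι) :
    Matrix (Fin d) (Fin d) ℝ :=
  (Matrix.of fun a b => y (i, a, b)) * (Matrix.of fun a b => y (i, a, b))ᵀ

lemma IsNonnegPolynomial.gram {ι : Type*} {d r : ℕ} (i : ι) (a b : Fin d) :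
    IsNonnegPolynomial (1 + 1) fun y : ι × Fin d × Fin r → ℝ => _root_.gram y i a b :=
  matrix_mul_transpose (fun a b => var (i, a, b)) a b

lemma gram_single {ι : Type*} [DecidableEq ι] {d r : ℕ} (i : ι) (a : Fin d) (b : Fin r) (u : ℝ)
    (i' : ι) : gram (Pi.single (i, a, b) u) i' =
      Matrix.diagonal (Pi.single a (if i' = i then u ^ 2 else 0)) := by
  ext a₁ a₂
  simp only [gram, Matrix.mul_apply, Matrix.of_apply, Matrix.transpose_apply, Pi.single_apply,
    Prod.mk.injEq, Matrix.diagonal_apply]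
  rw [Finset.sum_eq_single b]
  · by_cases h : i' = i <;> by_cases h₁ : a₁ = a <;> by_cases h₂ : a₂ = a <;>
      simp [h, h₁, h₂, sq, Ne.symm]
  · intro c _ hc
    simp [hc]
  · simp

lemma orderedProd_diagonal {d k : ℕ} (v : Fin k → Fin d → ℝ) :
    orderedProd (fun l => Matrix.diagonal (v l)) = Matrix.diagonal (∏ l, v l) := by
  induction k with
  | zero => simp [orderedProd]
  | succ k ih =>
    have := ih fun l => v l.succ
    simp only [orderedProd] at this
    simp only [orderedProd, List.ofFn_succ, List.prod_cons, this, Matrix.diagonal_mul_diagonal,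
      Fin.prod_univ_succ]
    rfl

lemma orderedProd_diagonal_single_apply {d k : ℕ} (a : Fin d) (c : Fin k → ℝ) :
    orderedProd (fun l => Matrix.diagonal (Pi.single a (c l))) a a = ∏ l, c l := by
  simp [orderedProd_diagonal (fun l => Pi.single a (c l))]

lemma palindromicProd_diagonal_single_apply {d k : ℕ} (a : Fin d) (c : Fin k → ℝ) :
    palindromicProd (fun l => Matrix.diagonal (Pi.single a (c l))) a a = (∏ l, c l) ^ 2 := by
  rw [palindromicProd, orderedProd_diagonal (fun l => Pi.single a (c l)),
    orderedProd_diagonal (fun l => Pi.single a (c l.rev)), Matrix.diagonal_mul_diagonal,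
    Matrix.diagonal_apply_eq]
  have h : ∏ l : Fin k, c l.rev = ∏ l, c l := Equiv.prod_comp Fin.revPerm c
  simp [sq, h]

section Means

variable {n k d r : ℕ} {f : (Fin k → Matrix (Fin d) (Fin d) ℝ) → Matrix (Fin d) (Fin d) ℝ}

lemma wrMean_gram_apply (x : Fin n × Fin d × Fin r → ℝ) (a b : Fin d) :
    wrMean f (gram x) a b =
      ((n : ℝ) ^ k)⁻¹ * ∑ j : Fin k → Fin n, f (gram (x ∘ Prod.map j id)) a b := by
  simp only [wrMean, Matrix.smul_apply, Matrix.sum_apply, smul_eq_mul]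
  rfl

lemma woMean_gram_apply (x : Fin n × Fin d × Fin r → ℝ) (a b : Fin d) :
    woMean f (gram x) a b =
      ((n - k)! : ℝ) / (n ! : ℝ) * ∑ j : Fin k ↪ Fin n, f (gram (x ∘ Prod.map j id)) a b := by
  simp only [woMean, Matrix.smul_apply, Matrix.sum_apply, smul_eq_mul]
  rfl

variable {ν : Measure ℝ} [IsProbabilityMeasure ν]

/-- If the with-replacement mean is integrable, then so is the `K`-th power of the entries. -/
lemma integrable_pow_of_integrable_wrMean (hν : ν.map (fun x => -x) = ν) {K : ℕ} (hK : Even K)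
    (hf : ∀ a b, IsNonnegPolynomial K fun y : Fin k × Fin d × Fin r → ℝ => f (gram y) a b)
    (hdiag : ∀ a (c : Fin k → ℝ), (∀ l, 0 ≤ c l) →
      0 ≤ f (fun l => Matrix.diagonal (Pi.single a (c l))) a a)
    (hpow : ∀ a (u : ℝ), f (fun _ => Matrix.diagonal (Pi.single a (u ^ 2))) a a = u ^ K)
    (q : Fin n × Fin d × Fin r)
    (hint : ∀ a b, Integrable (fun x : Fin n × Fin d × Fin r → ℝ => wrMean f (gram x) a b)
      (Measure.pi fun _ => ν)) :
    Integrable (fun u : ℝ => u ^ K) ν := by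
  obtain ⟨i, a, b⟩ := q
  have hn : ((n : ℝ) ^ k)⁻¹ ≠ 0 := inv_ne_zero (pow_ne_zero _ (by have := i.pos; positivity))
  have h := hint a a
  simp_rw [wrMean_gram_apply] at h
  rw [integrable_const_mul_iff (isUnit_iff_ne_zero.2 hn)] at h
  refine (IsNonnegPolynomial.sum Finset.univ
    fun j _ => (hf a a).rename (Prod.map j id)).integrable_pow hν h (i, a, b) hK fun u => ?_
  have e : ∀ j : Fin k → Fin n, f (gram (Pi.single (i, a, b) u ∘ Prod.map j id)) a a =
      f (fun l => Matrix.diagonal (Pi.single a (if j l = i then u ^ 2 else 0))) a a := fun j => by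
    simp_rw [← gram_single i a b u]
    rfl
  simp_rw [e]
  -- The constant tuple `i` already contributes `u ^ K`; the other tuples contribute nonnegative
  -- terms.
  refine le_trans (le_of_eq ?_) (Finset.single_le_sum (fun j _ => hdiag a _ fun l => ?_)
    (Finset.mem_univ fun _ => i))
  · simp [hpow]
  · split_ifs <;> positivity

/-- Comparison of the entries of the expected means, assuming enough finite moments. -/
lemma integral_woMean_le_integral_wrMean (hk : k ≤ n) (hν : ν.map (fun x => -x) = ν) {K : ℕ}
    (hK : Integrable (fun u : ℝ => u ^ K) ν)
    (hf : ∀ a b, IsNonnegPolynomial K fun y : Fin k × Fin d × Fin r → ℝ => f (gram y) a b)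
    (a b : Fin d) :
    Integrable (fun x : Fin n × Fin d × Fin r → ℝ => woMean f (gram x) a b)
      (Measure.pi fun _ => ν) ∧
    Integrable (fun x : Fin n × Fin d × Fin r → ℝ => wrMean f (gram x) a b)
      (Measure.pi fun _ => ν) ∧
    0 ≤ ∫ x : Fin n × Fin d × Fin r → ℝ, woMean f (gram x) a b ∂(Measure.pi fun _ => ν) ∧
    ∫ x : Fin n × Fin d × Fin r → ℝ, woMean f (gram x) a b ∂(Measure.pi fun _ => ν) ≤
      ∫ x : Fin n × Fin d × Fin r → ℝ, wrMean f (gram x) a b ∂(Measure.pi fun _ => ν) := by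
  obtain ⟨c, hc, h⟩ := (hf a b).exists_integral_comp_ge (τ := Fin n × Fin d × Fin r) hν hK
  have int := fun j : Fin k → Fin n => (h (Prod.map j id)).1
  simp_rw [woMean_gram_apply, wrMean_gram_apply]
  have ewo : ∫ x : Fin n × Fin d × Fin r → ℝ, ((n - k)! : ℝ) / (n ! : ℝ) *
      ∑ j : Fin k ↪ Fin n, f (gram (x ∘ Prod.map j id)) a b ∂(Measure.pi fun _ => ν) = c := by
    rw [integral_const_mul, integral_finsetSum _ fun (j : Fin k ↪ Fin n) _ => int j,
      Finset.sum_congr rfl fun (j : Fin k ↪ Fin n) _ =>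
        (h (Prod.map j id)).2.2 (j.injective.prodMap Function.injective_id)]
    rw [Finset.sum_const, Finset.card_univ, Fintype.card_embedding_eq, Fintype.card_fin,
      Fintype.card_fin, nsmul_eq_mul, ← mul_assoc, div_mul_eq_mul_div, ← Nat.cast_mul,
      Nat.factorial_mul_descFactorial hk, div_self (by positivity), one_mul]
  have ewr : c ≤ ∫ x : Fin n × Fin d × Fin r → ℝ, ((n : ℝ) ^ k)⁻¹ *
      ∑ j : Fin k → Fin n, f (gram (x ∘ Prod.map j id)) a b ∂(Measure.pi fun _ => ν) := by
    rw [integral_const_mul, integral_finsetSum _ fun j _ => int j]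
    -- If `n = 0`, then `k = 0` and `n ^ k = 1`.
    have hn : (0 : ℝ) < (n : ℝ) ^ k := by
      rcases Nat.eq_zero_or_pos n with rfl | hn
      · simp [Nat.le_zero.1 hk]
      · positivity
    rw [inv_mul_eq_div, le_div_iff₀ hn]
    calc c * (n : ℝ) ^ k = ∑ _j : Fin k → Fin n, c := by simp [mul_comm]
      _ ≤ _ := Finset.sum_le_sum fun j _ => (h (Prod.map j id)).2.1
  exact ⟨(integrable_finsetSum _ fun (j : Fin k ↪ Fin n) _ => int j).const_mul _,
    (integrable_finsetSum _ fun j _ => int j).const_mul _, ewo ▸ hc, ewo ▸ ewr⟩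

lemma norm_matrixExpectation_woMean_le {Ω : Type*} [MeasurableSpace Ω] {P : Measure Ω}
    (hk : k ≤ n) (hν : ν.map (fun x => -x) = ν) {K : ℕ} (hK : Integrable (fun u : ℝ => u ^ K) ν)
    (hf : ∀ a b, IsNonnegPolynomial K fun y : Fin k × Fin d × Fin r → ℝ => f (gram y) a b)
    {X : Ω → Fin n × Fin d × Fin r → ℝ} (hX : HasLaw X (Measure.pi fun _ => ν) P) :
    HasMatrixExpectation P (fun ω => woMean f (gram (X ω))) ∧
      ‖matrixExpectation P (fun ω => woMean f (gram (X ω)))‖ ≤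
        ‖matrixExpectation P (fun ω => wrMean f (gram (X ω)))‖ := by
  have h := integral_woMean_le_integral_wrMean (n := n) hk hν hK hf
  refine ⟨fun a b => ?_, Matrix.l2_opNorm_le_of_entrywise_le (fun a b => ?_) fun a b => ?_⟩
  · exact (hX.map_eq ▸ (h a b).1).comp_aemeasurable hX.aemeasurable
  · exact (h a b).2.2.1.trans_eq (hX.integral_comp (h a b).1.1).symm
  · refine (hX.integral_comp (h a b).1.1).trans_le ((h a b).2.2.2.trans_eq ?_)
    exact (hX.integral_comp (h a b).2.1.1).symm

/-- `hdiag` and `hpow` serve only to recover the `K`-th moment: when a single entry of the `Z i` is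
nonzero, every Gram matrix is diagonal with at most one nonzero entry. -/
lemma HasMatrixExpectation.woMean_of_wrMean {Ω : Type*} [MeasurableSpace Ω] {P : Measure Ω}
    [IsProbabilityMeasure P] (hk : k ≤ n) {ν : Measure ℝ} (hν : ν.map (fun x => -x) = ν)
    {Z : Fin n → Ω → Matrix (Fin d) (Fin r) ℝ}
    (hlaw : ∀ i a b, HasLaw (fun ω => Z i ω a b) ν P)
    (hindep : iIndepFun (fun (q : Fin n × Fin d × Fin r) (ω : Ω) => Z q.1 ω q.2.1 q.2.2) P)
    {A : Fin n → Ω → Matrix (Fin d) (Fin d) ℝ} (hA : ∀ i ω, A i ω = Z i ω * (Z i ω)ᵀ)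
    {K : ℕ} (hK : Even K)
    (hf : ∀ a b, IsNonnegPolynomial K fun y : Fin k × Fin d × Fin r → ℝ => f (gram y) a b)
    (hdiag : ∀ a (c : Fin k → ℝ), (∀ l, 0 ≤ c l) →
      0 ≤ f (fun l => Matrix.diagonal (Pi.single a (c l))) a a)
    (hpow : ∀ a (u : ℝ), f (fun _ => Matrix.diagonal (Pi.single a (u ^ 2))) a a = u ^ K)
    (hwr : HasMatrixExpectation P (fun ω => wrMean f (fun i => A i ω))) :
    HasMatrixExpectation P (fun ω => woMean f (fun i => A i ω)) ∧
      ‖matrixExpectation P (fun ω => woMean f (fun i => A i ω))‖ ≤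
        ‖matrixExpectation P (fun ω => wrMean f (fun i => A i ω))‖ := by
  set X : Ω → Fin n × Fin d × Fin r → ℝ := fun ω q => Z q.1 ω q.2.1 q.2.2 with hX
  have hAX : ∀ ω, (fun i => A i ω) = gram (X ω) := fun ω => funext fun i => hA i ω
  simp only [hAX] at hwr ⊢
  rcases isEmpty_or_nonempty (Fin n × Fin d × Fin r) with hq | ⟨⟨q⟩⟩
  · -- without any entry the law `ν` is unconstrained; replace it by a Dirac mass
    have hlawX : HasLaw X (Measure.pi fun _ => Measure.dirac (0 : ℝ)) P :=
      hindep.hasLaw_pi fun q => hq.elim q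
    exact norm_matrixExpectation_woMean_le hk (by simp [Measure.map_dirac])
      (integrable_dirac (by simp)) hf hlawX
  · have : IsProbabilityMeasure ν := (hlaw q.1 q.2.1 q.2.2).isProbabilityMeasure_iff.1 ‹_›
    have hlawX : HasLaw X (Measure.pi fun _ => ν) P :=
      hindep.hasLaw_pi fun q => hlaw q.1 q.2.1 q.2.2
    refine norm_matrixExpectation_woMean_le hk hν
      (integrable_pow_of_integrable_wrMean hν hK hf hdiag hpow q fun a b => ?_) hf hlawX
    -- Measurability lets integrability pass from `P` back to the product law.
    have hmeas : Measurable fun x : Fin n × Fin d × Fin r → ℝ => wrMean f (gram x) a b := by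
      simp_rw [wrMean_gram_apply]
      refine (Finset.measurable_sum _ fun j _ => ?_).const_mul _
      obtain ⟨p, -, -, hp⟩ := (hf a b).rename (Prod.map j id)
      simp_rw [hp]
      exact (MvPolynomial.continuous_eval p).measurable
    have := (integrable_map_measure hmeas.aestronglyMeasurable hlawX.aemeasurable).2 (hwr a b)
    rwa [hlawX.map_eq] at this

end Means

theorem mainTheorem3 {Ω : Type*} [MeasurableSpace Ω] (P : Measure Ω) [IsProbabilityMeasure P]
    (n k d r : ℕ) (hk : k ≤ n)
    -- the common law of the entries, symmetric about the origin
    (ν : Measure ℝ) (hν : ν.map (fun x => -x) = ν)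
    (Z : Fin n → Ω → Matrix (Fin d) (Fin r) ℝ)
    (hlaw : ∀ i a b, HasLaw (fun ω => Z i ω a b) ν P)
    (hindep : iIndepFun (fun (q : Fin n × Fin d × Fin r) (ω : Ω) => Z q.1 ω q.2.1 q.2.2) P)
    (A : Fin n → Ω → Matrix (Fin d) (Fin d) ℝ)
    (hA : ∀ i ω, A i ω = Z i ω * (Z i ω)ᵀ) :
    (HasMatrixExpectation P (fun ω => wrMean (k := k) orderedProd (fun i => A i ω)) →
      HasMatrixExpectation P (fun ω => woMean (k := k) orderedProd (fun i => A i ω)) ∧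
      ‖matrixExpectation P (fun ω => woMean (k := k) orderedProd (fun i => A i ω))‖ ≤
        ‖matrixExpectation P (fun ω => wrMean (k := k) orderedProd (fun i => A i ω))‖) ∧
    (HasMatrixExpectation P (fun ω => wrMean (k := k) palindromicProd (fun i => A i ω)) →
      HasMatrixExpectation P (fun ω => woMean (k := k) palindromicProd (fun i => A i ω)) ∧
      ‖matrixExpectation P (fun ω => woMean (k := k) palindromicProd (fun i => A i ω))‖ ≤
        ‖matrixExpectation P (fun ω => wrMean (k := k) palindromicProd (fun i => A i ω))‖) := by
  constructor
  -- Each of the `k` Gram factors has degree 2 in the entries; the palindromic product has twice as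
  -- many factors.
  · refine HasMatrixExpectation.woMean_of_wrMean hk hν hlaw hindep hA (K := k * (1 + 1))
      (by simp) (IsNonnegPolynomial.orderedProd IsNonnegPolynomial.gram) (fun a c hc => ?_)
      fun a u => ?_
    · rw [orderedProd_diagonal_single_apply]
      exact Finset.prod_nonneg fun l _ => hc l
    · rw [orderedProd_diagonal_single_apply]
      simp [← pow_mul, mul_comm]
  · refine HasMatrixExpectation.woMean_of_wrMean hk hν hlaw hindep hA
      (K := k * (1 + 1) + k * (1 + 1))
      (by simp) (IsNonnegPolynomial.palindromicProd IsNonnegPolynomial.gram) (fun a c _ => ?_)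
      fun a u => ?_
    · rw [palindromicProd_diagonal_single_apply]
      positivity
    · rw [palindromicProd_diagonal_single_apply]
      simp only [Finset.prod_const, Finset.card_univ, Fintype.card_fin]
      ring
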